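/- Let $n,k,d$ be positive integers and let $K$ be an algebraically closed field whose characteristic is $0$ or a prime $p$ with $p>kd$ and $p>2d$. Let $W$ be a $K$-vector space with basis $w_0,\dots,w_n$ and dual basis $x_0,\dots,x_n$ of $W^*$. The group $\mathrm{GL}_{n+1}$ acts on $\mathrm{Sym}^m(W^*)$ through the contragredient action on $W^*$, that is $(g\cdot f)(v)=f(g^{-1}v)$. Let $D:\mathrm{Sym}(W)\times\mathrm{Sym}(W^*)\to\mathrm{Sym}(W^*)$ be the $K$-bilinear map with $$D(w_0^{\alpha_0}\cdots w_n^{\alpha_n},P)=\frac{\partial^{\alpha_0+\cdots+\alpha_n}P}{\partial x_0^{\alpha_0}\cdots\partial x_n^{\alpha_n}}.$$ A covariant of order $d$ of $\mathrm{Sym}^{kd}(W^*)$ is an $\mathrm{SL}_{n+1}$-equivariant homogeneous polynomial map $\mathrm{Sym}^{kd}(W^*)\to\mathrm{Sym}^{d}(W^*)$. An invariant is an $\mathrm{SL}_{n+1}$-invariant homogeneous polynomial function $\mathrm{Sym}^{kd}(W^*)\to K$. Put $r=\dim_K\mathrm{Sym}^d(W^*)-1$, and let $q_0,\dots,q_r$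 be covariants of order $d$ of $\mathrm{Sym}^{kd}(W^*)$ which are generically linearly independent: there is a dense open subset of the quotient $\mathrm{Sym}^{kd}(W^*)/\!/\mathrm{SL}_{n+1}=\mathrm{Spec}\,K[\mathrm{Sym}^{kd}(W^*)]^{\mathrm{SL}_{n+1}}$ such that $q_0(f),\dots,q_r(f)$ are linearly independent for every $f$ whose image lies in it. Let $b_0,\dots,b_r$ be the monomials of degree $d$ in $x_0,\dots,x_n$, in any fixed order, and let $b_0^*,\dots,b_r^*$ be the basis of $\mathrm{Sym}^d(W)$ with $D(b_i^*,b_j)=\delta_{ij}$. Let $S(f)$ be the matrix whose columns are the coordinates of $q_0(f),\dots,q_r(f)$ in the basis $(b_i)$, and let $\Delta=\det S$. Let $\Delta q_i^*:\mathrm{Sym}^{kd}(W^*)\to\mathrm{Sym}^d(W)$ be the map whose coordinates in the basis $(b_j^*)$ form the $i$-th column of the cofactor matrix $\Delta\,{}^tS^{-1}$ (the transpose of the adjugate of $S$). Thus, where $\Delta(f)\neq0$, the $\Delta q_i^*(f)$ are $\Delta(f)$ times the dual basis of $(q_i(f))_i$. Then the functions $$f\mapsto D(\Delta q_{i_1}^*(f)\cdots\Delta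 q_{i_k}^*(f),\,f)\quad(0\le i_1,\dots,i_k\le r)$$ and $$f\mapsto D(\Delta q_i^*(f)\,\Delta q_j^*(f),\,q_l(f)q_m(f))\quad(0\le i,j,l,m\le r)$$ are invariants of $\mathrm{Sym}^{kd}(W^*)$. For a general $f\in\mathrm{Sym}^{kd}(W^*)$ their values at $f$ determine a form $f'$ that is $\mathrm{GL}_{n+1}$-equivalent to $f$. Precisely: there is a dense open subset $U$ of $\mathrm{Sym}^{kd}(W^*)/\!/\mathrm{SL}_{n+1}$ such that the image of $f$ lies in $U$ if and only if $q_0(f),\dots,q_r(f)$ are linearly independent, and there is a map $R$, from the set of possible tuples of values to $\mathrm{Sym}^{kd}(W^*)$, such that for every $f$ with image in $U$ the form $f'=R(\text{values at }f)$ is $\mathrm{GL}_{n+1}$-equivalent to $f$. -/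

import Mathlib

open MvPolynomial

noncomputable section

namespace FormReconstruction

/-! Coordinates are used throughout: `W` has basis `w_0, …, w_n` and `W*` the dual basis
`x_0, …, x_n`.  Both `Sym(W)` and `Sym(W*)` are polynomial rings in `n + 1` variables, the
variable `X i` being `w_i` in the first case and `x_i` in the second. -/

/-- `Sym^m(W*)`: forms of degree `m` in `x_0, …, x_n`. -/
abbrev Form (n m : ℕ) (K : Type*) [Field K] : Type _ :=
  homogeneousSubmodule (Fin (n + 1)) K m

/-- `Sym^m(W)`: forms of degree `m` in `w_0, …, w_n`. -/
abbrev DualForm (n m : ℕ) (K : Type*) [Field K] : Type _ :=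
  homogeneousSubmodule (Fin (n + 1)) K m

/-- Exponents of the monomials of degree `m` in `n + 1` variables. -/
abbrev Mon (n m : ℕ) : Type :=
  {α : Fin (n + 1) →₀ ℕ // α.degree = m}

variable {K : Type*} [Field K]

/-- The algebra endomorphism that substitutes the linear form `∑ i, A i j * X i` for `X j`. -/
def linSubst {n : ℕ} (A : Matrix (Fin (n + 1)) (Fin (n + 1)) K) :
    MvPolynomial (Fin (n + 1)) K →ₐ[K] MvPolynomial (Fin (n + 1)) K :=
  aeval fun j => ∑ i, C (A i j) * X i

theorem linSubst_isHomogeneous {n m : ℕ} (A : Matrix (Fin (n + 1)) (Fin (n + 1)) K)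
    {f : MvPolynomial (Fin (n + 1)) K} (hf : f.IsHomogeneous m) :
    (linSubst A f).IsHomogeneous m := by
  have h := hf.aeval (fun j => ∑ i, C (A i j) * X i)
    (fun j => IsHomogeneous.sum _ _ 1 fun i _ => isHomogeneous_C_mul_X (A i j) i)
  rwa [one_mul] at h

/-- The action of `GL_{n+1}` on `Sym^m(W*)` induced by the contragredient action
`x ↦ ᵗg⁻¹ x` on `W*`; as a function on `W`, `g · f` is `v ↦ f (g⁻¹ v)`. -/
def act {n m : ℕ} (g : GL (Fin (n + 1)) K) (f : Form n m K) : Form n m K :=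
  ⟨linSubst ((g⁻¹ : GL (Fin (n + 1)) K) : Matrix (Fin (n + 1)) (Fin (n + 1)) K).transpose f.1,
    (mem_homogeneousSubmodule _ _).2
      (linSubst_isHomogeneous _ ((mem_homogeneousSubmodule _ _).1 f.2))⟩

/-- The action of `SL_{n+1}`, a subgroup of `GL_{n+1}`. -/
def actSL {n m : ℕ} (g : Matrix.SpecialLinearGroup (Fin (n + 1)) K) (f : Form n m K) :
    Form n m K :=
  act (Matrix.SpecialLinearGroup.toGL g) f

/-- `f` and `f'` are `GL_{n+1}`-equivalent. -/
def GLEquivalent {n m : ℕ} (f f' : Form n m K) : Prop :=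
  ∃ g : GL (Fin (n + 1)) K, act g f = f'

/-! ### Polynomial maps, invariants, covariants -/

/-- The coefficients of a form. -/
def coords {n m : ℕ} (f : Form n m K) : Mon n m → K := fun α => coeff α.1 f.1

/-- `I` is a homogeneous polynomial function of degree `e` in the coefficients of the form. -/
def IsHomogPolyFun {n m : ℕ} (e : ℕ) (I : Form n m K → K) : Prop :=
  ∃ P : MvPolynomial (Mon n m) K, P.IsHomogeneous e ∧ ∀ f, I f = eval (coords f) P

/-- Invariants of `Sym^m(W*)`. -/
def IsInvariant {n m : ℕ} (I : Form n m K → K) : Prop :=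
  (∃ e, IsHomogPolyFun e I) ∧ ∀ g f, I (actSL g f) = I f

/-- Covariants of order `d` of `Sym^m(W*)`: the `SL_{n+1}`-equivariant homogeneous polynomial
maps from `Sym^m(W*)` to `Sym^d(W*)`. -/
def IsCovariant {n m d : ℕ} (q : Form n m K → Form n d K) : Prop :=
  (∃ e, ∀ α : Mon n d, IsHomogPolyFun e fun f => coords (q f) α) ∧
    ∀ g f, q (actSL g f) = actSL g (q f)

/-- The algebra `K[Sym^m(W*)]^{SL_{n+1}}` of invariant polynomial functions. -/
def invariantAlgebra (n m : ℕ) (K : Type*) [Field K] :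
    Subalgebra K (MvPolynomial (Mon n m) K) where
  carrier := {P | ∀ (g : Matrix.SpecialLinearGroup (Fin (n + 1)) K) (f : Form n m K),
    eval (coords (actSL g f)) P = eval (coords f) P}
  mul_mem' := fun {P Q} hP hQ g f => by rw [map_mul, map_mul, hP g f, hQ g f]
  add_mem' := fun {P Q} hP hQ g f => by rw [map_add, map_add, hP g f, hQ g f]
  algebraMap_mem' := fun c g f => by simp [algebraMap_eq]

/-- The quotient `Sym^m(W*) // SL_{n+1} = Spec K[Sym^m(W*)]^{SL_{n+1}}`, as a topological
space with the Zariski topology. -/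
abbrev Quotient (n m : ℕ) (K : Type*) [Field K] : Type _ :=
  PrimeSpectrum (invariantAlgebra n m K)

/-- The point of the quotient below `f`: the ideal of the invariants that vanish at `f`. -/
def quotientPoint {n m : ℕ} (f : Form n m K) : Quotient n m K :=
  ⟨RingHom.ker ((eval (coords f)).comp (invariantAlgebra n m K).val.toRingHom),
    RingHom.ker_isPrime _⟩

/-- The maps `q i` are linearly independent at `f` for all `f` over some dense open subset of
the quotient. -/
def GenericallyLinearIndependent {n m d : ℕ} {ι : Type*} (q : ι → Form n m K → Form n d K) :
    Prop :=
  ∃ U : Set (Quotient n m K), IsOpen U ∧ Dense U ∧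
    ∀ f, quotientPoint f ∈ U → LinearIndependent K fun i => q i f

/-! ### Apolarity -/

/-- The differential operator `∂^α = ∂^|α| / ∂x_0^{α_0} ⋯ ∂x_n^{α_n}`. -/
def partialOp {n : ℕ} (α : Fin (n + 1) →₀ ℕ) :
    Module.End K (MvPolynomial (Fin (n + 1)) K) :=
  (List.ofFn fun i => (pderiv i).toLinearMap ^ α i).prod

/-- The bilinear map `D : Sym(W) × Sym(W*) → Sym(W*)` with `D (w^α, P) = ∂^α P`. -/
def apolar {n : ℕ} :
    MvPolynomial (Fin (n + 1)) K →ₗ[K] Module.End K (MvPolynomial (Fin (n + 1)) K) :=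
  (basisMonomials (Fin (n + 1)) K).constr K partialOp

/-- The value of `D (p, P)` in `Sym^0(W*) = K`, for `p` and `P` of the same degree. -/
def pairing {n : ℕ} (p P : MvPolynomial (Fin (n + 1)) K) : K :=
  constantCoeff (apolar p P)

/-- The dual basis `b_α^* = w^α / α!` of the monomial basis `b_α = x^α` of `Sym^d(W*)`. -/
def dualMonomial {n d : ℕ} (α : Mon n d) : DualForm n d K :=
  ⟨monomial α.1 (∏ i, ((α.1 i).factorial : K))⁻¹,
    (mem_homogeneousSubmodule _ _).2 (isHomogeneous_monomial _ α.2)⟩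

/-! ### The invariants used for the reconstruction

The monomial basis `b_0, …, b_r` of `Sym^d(W*)` is given by an enumeration `e` of the
exponents of degree `d`; `q = (q_0, …, q_r)` are maps from `Sym^m(W*)` to `Sym^d(W*)`. -/

section Data

variable {n m d r : ℕ} (e : Fin (r + 1) ≃ Mon n d) (q : Fin (r + 1) → Form n m K → Form n d K)

/-- The matrix `S(f)` whose `j`-th column holds the coordinates of `q_j(f)` in the monomial
basis. -/
def basisMatrix (f : Form n m K) : Matrix (Fin (r + 1)) (Fin (r + 1)) K :=
  Matrix.of fun i j => coords (q j f) (e i)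

/-- `Δ = det S`. -/
def Delta (f : Form n m K) : K := (basisMatrix e q f).det

/-- `Δ q_i^*`.  Its coordinates in the basis `b_0^*, …, b_r^*` of `Sym^d(W)` are the `i`-th
column of `Δ ᵗS⁻¹`, that is of the transpose of the adjugate matrix of `S`. -/
def deltaDual (i : Fin (r + 1)) (f : Form n m K) : DualForm n d K :=
  ∑ j, (basisMatrix e q f).adjugate.transpose j i • dualMonomial (e j)

/-- The coefficients `D(Δ q_{i_1}^* ⋯ Δ q_{i_k}^*, Id)(f)`. -/
def formInvariant {k : ℕ} (i : Fin k → Fin (r + 1)) (f : Form n m K) : K :=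
  pairing (∏ t, (deltaDual e q (i t) f).1) f.1

/-- The matrix `(D(Δ q_i^* Δ q_j^*, q_l q_m)(f))`, with rows `(i, j)` and columns `(l, m)`. -/
def matrixInvariant (f : Form n m K) :
    Matrix (Fin (r + 1) × Fin (r + 1)) (Fin (r + 1) × Fin (r + 1)) K :=
  Matrix.of fun a b => pairing ((deltaDual e q a.1 f).1 * (deltaDual e q a.2 f).1)
    ((q b.1 f).1 * (q b.2 f).1)

end Data

end FormReconstruction

end

noncomputable section

namespace FormReconstruction

variable {K : Type*} [Field K]

/-! ### The pairing in coordinates -/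

/-! Where `Delta` is nonzero, the forms `q_i(f)` are a basis of `Sym^d(W*)` and the `Δq_i^*(f)` are
a multiple of its dual basis. The numbers `D(Δq_{i_1}^* ⋯ Δq_{i_k}^*, f)` therefore describe `f` in
this moving frame, up to a scalar. It remains to recover the frame up to a linear change of
variables.

The matrix invariants do this. The characteristic bound makes the pairing on degree `2d` perfect, so
their kernel is exactly the space of quadratic relations among the `q_i(f)`
(`matrixInvariant_kernel`). If `f` and `f'` have the same matrix, the linear map `q_i(f) ↦ q_i(f')`
preserves these relations, in particular the equations of the Veronese variety. Such a map is
induced by an invertible substitution `A` (`exists_linSubst_of_relations`). The pairing is unchanged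
when its two sides move contragrediently, so the remaining values force `A f` and `f'` to agree up
to a nonzero scalar, which a root extraction absorbs into `A` (`glEquivalent_of_values_eq`).

Invariance comes from the same property of the pairing, together with the fact that `SL_{n+1}` acts
on `Sym^d` with determinant 1 (`det_substForm`), so that `Delta` and the scaled dual basis transform
without an extra factor. The open set is the locus `Delta ≠ 0`, dense because the algebra of
invariants is a domain. -/

theorem coeff_pderiv_pow {n : ℕ} (i : Fin (n + 1)) (a : ℕ) (β : Fin (n + 1) →₀ ℕ)
    (P : MvPolynomial (Fin (n + 1)) K) :
    coeff β (((pderiv i).toLinearMap ^ a : Module.End K _) P) =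
      ((β i + 1).ascFactorial a : K) * coeff (β + Finsupp.single i a) P := by
  induction a generalizing β with
  | zero => simp
  | succ a ih =>
    rw [pow_succ', Module.End.mul_apply, Derivation.coeFn_coe, coeff_pderiv, ih, add_assoc,
      ← Finsupp.single_add, add_comm 1 a, Finsupp.add_apply, Finsupp.single_eq_same,
      Nat.ascFactorial_succ, ← Nat.succ_ascFactorial]
    push_cast
    ring

/-- Without repetitions in `l`, raising the exponent at one index leaves the factors of the other
indices unchanged. -/
theorem coeff_prod_pderiv_pow {n : ℕ} (α : Fin (n + 1) → ℕ) (l : List (Fin (n + 1)))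
    (hl : l.Nodup) (β : Fin (n + 1) →₀ ℕ) (P : MvPolynomial (Fin (n + 1)) K) :
    coeff β ((l.map fun i => ((pderiv i).toLinearMap ^ α i : Module.End K _)).prod P) =
      (l.map fun i => ((β i + 1).ascFactorial (α i) : K)).prod *
        coeff (β + (l.map fun i => Finsupp.single i (α i)).sum) P := by
  induction l generalizing β with
  | nil => simp
  | cons i l ih =>
    obtain ⟨hi, hl⟩ := List.nodup_cons.1 hl
    simp only [List.map_cons, List.prod_cons, List.sum_cons]
    rw [Module.End.mul_apply, coeff_pderiv_pow, ih hl, add_assoc, mul_assoc]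
    congr 3
    refine List.map_congr_left fun j hj => ?_
    have : i ≠ j := fun h => hi (h ▸ hj)
    simp [Finsupp.single_eq_of_ne this.symm]

theorem constantCoeff_partialOp {n : ℕ} (α : Fin (n + 1) →₀ ℕ)
    (P : MvPolynomial (Fin (n + 1)) K) :
    constantCoeff (partialOp α P) = (∏ i, ((α i).factorial : K)) * coeff α P := by
  have h := coeff_prod_pderiv_pow (α ·) (List.finRange (n + 1)) (List.nodup_finRange _) 0 P
  rw [← List.ofFn_eq_map, ← List.ofFn_eq_map, ← List.ofFn_eq_map, List.prod_ofFn,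
    List.sum_ofFn] at h
  simp only [Finsupp.coe_zero, Pi.zero_apply, zero_add, Nat.one_ascFactorial] at h
  rw [Finsupp.univ_sum_single] at h
  exact h

theorem pairing_monomial {n : ℕ} (α : Fin (n + 1) →₀ ℕ) (c : K)
    (P : MvPolynomial (Fin (n + 1)) K) :
    pairing (monomial α c) P = c * ((∏ i, ((α i).factorial : K)) * coeff α P) := by
  have h : monomial α c = c • basisMonomials (Fin (n + 1)) K α := by
    rw [coe_basisMonomials, smul_monomial, smul_eq_mul, mul_one]
  rw [pairing, apolar, h, map_smul, Module.Basis.constr_basis, LinearMap.smul_apply,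
    smul_eq_C_mul, map_mul, constantCoeff_C, constantCoeff_partialOp]

/-- The pairing as a bilinear form. -/
def pairingBilin (n : ℕ) (K : Type*) [Field K] :
    MvPolynomial (Fin (n + 1)) K →ₗ[K] MvPolynomial (Fin (n + 1)) K →ₗ[K] K :=
  LinearMap.mk₂ K pairing
    (fun p q P => by simp [pairing])
    (fun c p P => by
      rw [pairing, map_smul, LinearMap.smul_apply, smul_eq_C_mul, map_mul, constantCoeff_C,
        pairing, smul_eq_mul])
    (fun p P Q => by simp [pairing])
    (fun c p P => by
      rw [pairing, map_smul, smul_eq_C_mul, map_mul, constantCoeff_C, pairing, smul_eq_mul])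

theorem pairing_eq_bilin {n : ℕ} (p P : MvPolynomial (Fin (n + 1)) K) :
    pairing p P = pairingBilin n K p P := rfl

/-- Multiplication by `w_j` is adjoint to `∂/∂x_j`. With the chain rule `pderiv_linSubst`, this
gives `pairing_linSubst` by induction on `p`. -/
theorem pairing_X_mul {n : ℕ} (j : Fin (n + 1)) (p P : MvPolynomial (Fin (n + 1)) K) :
    pairing (X j * p) P = pairing p (pderiv j P) := by
  induction p using MvPolynomial.induction_on' with
  | add p q hp hq =>
    simp only [mul_add, pairing_eq_bilin, map_add, LinearMap.add_apply] at *
    rw [hp, hq]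
  | monomial α c =>
    rw [X, monomial_mul, one_mul, pairing_monomial, pairing_monomial, coeff_pderiv,
      add_comm (Finsupp.single j 1) α]
    have h : ∏ i, (((α + Finsupp.single j 1 : Fin (n + 1) →₀ ℕ) i).factorial : K) =
        (∏ i, ((α i).factorial : K)) * (α j + 1) := by
      rw [← Finset.mul_prod_erase _ _ (Finset.mem_univ j),
        ← Finset.mul_prod_erase Finset.univ (fun i => ((α i).factorial : K)) (Finset.mem_univ j)]
      have : ∀ i ∈ Finset.univ.erase j,
          (((α + Finsupp.single j 1 : Fin (n + 1) →₀ ℕ) i).factorial : K) = ((α i).factorial : K) := fun i hi => by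
        simp [Finsupp.single_eq_of_ne (Finset.ne_of_mem_erase hi)]
      rw [Finset.prod_congr rfl this]
      simp only [Finsupp.add_apply, Finsupp.single_eq_same, Nat.factorial_succ]
      push_cast
      ring
    rw [h]
    ring

theorem linSubst_X {n : ℕ} (A : Matrix (Fin (n + 1)) (Fin (n + 1)) K) (j : Fin (n + 1)) :
    linSubst A (X j) = ∑ i, C (A i j) * X i := by
  simp [linSubst]

theorem linSubst_mul {n : ℕ} (A B : Matrix (Fin (n + 1)) (Fin (n + 1)) K) :
    linSubst (A * B) = (linSubst A).comp (linSubst B) := by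
  refine MvPolynomial.algHom_ext fun j => ?_
  simp only [AlgHom.comp_apply, linSubst_X, map_sum, map_mul, algHom_C, algebraMap_eq,
    Finset.mul_sum, Matrix.mul_apply, Finset.sum_mul]
  rw [Finset.sum_comm]
  refine Finset.sum_congr rfl fun i _ => Finset.sum_congr rfl fun l _ => ?_
  ring

theorem linSubst_mul_apply {n : ℕ} (A B : Matrix (Fin (n + 1)) (Fin (n + 1)) K)
    (p : MvPolynomial (Fin (n + 1)) K) :
    linSubst (A * B) p = linSubst A (linSubst B p) := by
  rw [linSubst_mul, AlgHom.comp_apply]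

theorem linSubst_one {n : ℕ} :
    linSubst (1 : Matrix (Fin (n + 1)) (Fin (n + 1)) K) = AlgHom.id K _ := by
  refine MvPolynomial.algHom_ext fun j => ?_
  simp [linSubst_X, Matrix.one_apply]

theorem pderiv_linSubst {n : ℕ} (A : Matrix (Fin (n + 1)) (Fin (n + 1)) K) (j : Fin (n + 1))
    (P : MvPolynomial (Fin (n + 1)) K) :
    pderiv j (linSubst A P) = ∑ i, A j i • linSubst A (pderiv i P) := by
  induction P using MvPolynomial.induction_on with
  | C a => simp [algHom_C]
  | add p q hp hq => simp only [map_add, hp, hq, smul_add, Finset.sum_add_distrib]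
  | mul_X p l hp =>
    have hX : pderiv j (linSubst A (X l)) = C (A j l) := by
      rw [linSubst_X, map_sum, Finset.sum_eq_single j]
      · simp
      · intro i _ hi
        simp [pderiv_X_of_ne hi]
      · simp
    simp only [map_mul, pderiv_mul, hX, hp, map_add, smul_add, Finset.sum_add_distrib,
      Finset.sum_mul]
    congr 1
    · simp
    · rw [Finset.sum_eq_single l]
      · simp [smul_eq_C_mul, mul_comm]
      · intro i _ hi
        simp [pderiv_X_of_ne hi.symm]
      · simp

theorem pairing_linSubst {n : ℕ} (B : Matrix (Fin (n + 1)) (Fin (n + 1)) K)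
    (p P : MvPolynomial (Fin (n + 1)) K) :
    pairing (linSubst B p) P = pairing p (linSubst B.transpose P) := by
  induction p using MvPolynomial.induction_on generalizing P with
  | C a =>
    rw [algHom_C, algebraMap_eq, C_apply, pairing_monomial, pairing_monomial]
    congr 2
    have h : constantCoeff.comp (linSubst B.transpose).toRingHom =
        (constantCoeff : MvPolynomial (Fin (n + 1)) K →+* K) :=
      MvPolynomial.ringHom_ext (fun r => by simp) fun i => by simp [linSubst_X]
    exact (DFunLike.congr_fun h P).symm
  | add p q hp hq =>
    simp only [pairing_eq_bilin, map_add, LinearMap.add_apply] at *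
    rw [hp, hq]
  | mul_X p l hp =>
    rw [mul_comm, map_mul, linSubst_X, pairing_X_mul, pderiv_linSubst, Finset.sum_mul]
    rw [pairing_eq_bilin, pairing_eq_bilin, map_sum, map_sum, LinearMap.sum_apply]
    refine Finset.sum_congr rfl fun i _ => ?_
    rw [mul_assoc, ← smul_eq_C_mul, map_smul, map_smul, LinearMap.smul_apply,
      ← pairing_eq_bilin, ← pairing_eq_bilin, pairing_X_mul, hp, Matrix.transpose_apply]

theorem pairing_linSubst_linSubst {n : ℕ} {A B : Matrix (Fin (n + 1)) (Fin (n + 1)) K}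
    (h : B.transpose * A = 1) (p P : MvPolynomial (Fin (n + 1)) K) :
    pairing (linSubst B p) (linSubst A P) = pairing p P := by
  rw [pairing_linSubst, ← linSubst_mul_apply, h, linSubst_one, AlgHom.id_apply]

/-! ### Nondegeneracy -/

theorem natCast_factorial_ne_zero {m a : ℕ} (h : ringChar K = 0 ∨ m < ringChar K) (ha : a ≤ m) :
    (a.factorial : K) ≠ 0 := by
  intro h0
  have hdvd := ringChar.dvd h0
  rcases h with h | h
  · rw [h, zero_dvd_iff] at hdvd
    exact Nat.factorial_ne_zero _ hdvd
  · rcases CharP.char_is_prime_or_zero K (ringChar K) with hp | hp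
    · exact absurd ((hp.dvd_factorial).1 hdvd) (by omega)
    · omega

theorem prod_factorial_ne_zero {n m : ℕ} (h : ringChar K = 0 ∨ m < ringChar K)
    {α : Fin (n + 1) →₀ ℕ} (hα : α.degree ≤ m) : ∏ i, ((α i).factorial : K) ≠ 0 :=
  Finset.prod_ne_zero_iff.2 fun i _ =>
    natCast_factorial_ne_zero h ((Finsupp.le_degree i α).trans hα)

/-- On monomials the pairing is diagonal with entries `∏ α_i!`, and the characteristic bound keeps
these nonzero. -/
theorem eq_zero_of_pairing_left {n m : ℕ} (h : ringChar K = 0 ∨ m < ringChar K)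
    {P : MvPolynomial (Fin (n + 1)) K} (hP : P.IsHomogeneous m)
    (h0 : ∀ p : MvPolynomial (Fin (n + 1)) K, p.IsHomogeneous m → pairing p P = 0) : P = 0 := by
  ext α
  by_cases hα : α.degree = m
  · have := h0 (monomial α 1) (isHomogeneous_monomial _ hα)
    rw [pairing_monomial, one_mul] at this
    simpa using (mul_eq_zero.1 this).resolve_left (prod_factorial_ne_zero h hα.le)
  · simpa using hP.coeff_eq_zero hα

theorem pairing_comm {n : ℕ} (p P : MvPolynomial (Fin (n + 1)) K) :
    pairing p P = pairing P p := by
  induction p using MvPolynomial.induction_on' with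
  | add p q hp hq => simp only [pairing_eq_bilin, map_add, LinearMap.add_apply] at *; rw [hp, hq]
  | monomial α c =>
    induction P using MvPolynomial.induction_on' with
    | add p q hp hq => simp only [pairing_eq_bilin, map_add, LinearMap.add_apply] at *; rw [hp, hq]
    | monomial β b =>
      rw [pairing_monomial, pairing_monomial, coeff_monomial, coeff_monomial]
      by_cases hαβ : α = β
      · subst hαβ
        simp only [if_true]
        ring
      · simp [hαβ, Ne.symm hαβ]

theorem homogeneousSubmodule_pow {σ : Type*} (k d : ℕ) :
    homogeneousSubmodule σ K d ^ k = homogeneousSubmodule σ K (k * d) := by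
  rw [← homogeneousSubmodule_one_pow (R := K) (n := d),
    ← homogeneousSubmodule_one_pow (R := K) (n := k * d), ← pow_mul, mul_comm d k]

-- `Sym^{kd}` is the `k`-th power of `Sym^d`, so `k`-fold products of a spanning family span it and
-- suffice as test vectors.
open scoped Pointwise in
theorem eq_zero_of_pairing_prod {n k d : ℕ} {ι : Type*}
    (h : ringChar K = 0 ∨ k * d < ringChar K) {p : ι → MvPolynomial (Fin (n + 1)) K}
    (hp : Submodule.span K (Set.range p) = homogeneousSubmodule (Fin (n + 1)) K d)
    {P : MvPolynomial (Fin (n + 1)) K} (hP : P.IsHomogeneous (k * d))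
    (h0 : ∀ i : Fin k → ι, pairing (∏ t, p (i t)) P = 0) : P = 0 := by
  refine eq_zero_of_pairing_left h hP fun f hf => ?_
  have hf' : f ∈ homogeneousSubmodule (Fin (n + 1)) K (k * d) := hf
  rw [← homogeneousSubmodule_pow, ← hp, Submodule.span_pow] at hf'
  have : Submodule.span K (Set.range p ^ k) ≤ LinearMap.ker ((pairingBilin n K).flip P) := by
    refine Submodule.span_le.2 fun x hx => ?_
    obtain ⟨g, rfl⟩ := Set.mem_pow.1 hx
    choose i hi using fun t => (g t).2
    rw [SetLike.mem_coe, LinearMap.mem_ker, LinearMap.flip_apply, ← pairing_eq_bilin,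
      List.prod_ofFn]
    simpa [hi] using h0 i
  exact this hf'

/-! ### Multiplicative functions of matrices are trivial on the special linear group -/

/-- The values of `δ` commute, so `δ` does not distinguish conjugate matrices; it is enough to treat
generators of `SL`. A two-entry diagonal generator is a quotient of two conjugate matrices `D i c`
and `D j c`. A transvection is a commutator of `D i a` with another transvection. -/
theorem monoidHom_specialLinearGroup_eq_one {ι : Type*} [Fintype ι] [DecidableEq ι] [Infinite K]
    (δ : Matrix ι ι K →* K) (g : Matrix.SpecialLinearGroup ι K) : δ g.1 = 1 := by
  classical
  have hne : ∀ {A B : Matrix ι ι K}, A * B = 1 → δ A ≠ 0 := fun {A B} h h0 => by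
    have := congrArg δ h
    rw [map_mul, h0, zero_mul, map_one] at this
    exact zero_ne_one this
  rcases subsingleton_or_nontrivial ι with hι | hι
  · rw [Subsingleton.elim g 1]
    exact map_one δ
  let D : ι → K → Matrix ι ι K := fun i c => Matrix.diagonal (Function.update 1 i c)
  have hD : ∀ i {c : K}, c ≠ 0 → D i c * D i c⁻¹ = 1 := fun i c hc => by
    simp only [D, Matrix.diagonal_mul_diagonal]
    rw [← Matrix.diagonal_one]
    congr 1
    ext l
    by_cases hl : l = i
    · subst hl; simp [hc]
    · simp [hl]
  refine Matrix.SpecialLinearGroup.diagonal_transvection_induction' (fun g => δ g.1 = 1) g ?_ ?_ ?_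
  · intro i j hij c hc
    have h1 : (Matrix.SpecialLinearGroup.diag2n hij c hc).1 * D j c = D i c := by
      rw [Matrix.SpecialLinearGroup.diag2n_coe, Matrix.diagonal_mul_diagonal]
      congr 1
      ext l
      by_cases hi : l = i
      · subst hi; simp [hij]
      · by_cases hj : l = j
        · subst hj; simp [hi, hc]
        · simp [hi, hj]
    let P : Matrix ι ι K := (Equiv.swap i j).toPEquiv.toMatrix
    have hP : P * P = 1 := by
      rw [← PEquiv.toMatrix_trans, ← Equiv.toPEquiv_trans]
      simp [PEquiv.toMatrix_refl]
    have h2 : D i c * P = P * D j c := by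
      ext a b
      simp only [D, P, Matrix.diagonal_mul, Matrix.mul_diagonal, PEquiv.toMatrix_apply,
        Equiv.toPEquiv_apply, Option.mem_def, Option.some.injEq]
      by_cases h : Equiv.swap i j a = b
      · subst h
        have : Equiv.swap i j a = j ↔ a = i := by
          rw [Equiv.swap_apply_eq_iff, Equiv.swap_apply_right]
        simp [Function.update_apply, this]
      · simp [h]
    have h3 := congrArg δ h2
    rw [map_mul, map_mul, mul_comm] at h3
    have h4 := mul_left_cancel₀ (hne hP) h3
    have h5 := congrArg δ h1
    rw [map_mul, h4] at h5
    exact mul_eq_right₀ (hne (hD j hc)) |>.1 h5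
  · intro i j hij b
    change δ (Matrix.transvection i j b) = 1
    obtain ⟨a, ha⟩ := Infinite.exists_notMem_finset ({0, 1} : Finset K)
    simp only [Finset.mem_insert, Finset.mem_singleton, not_or] at ha
    -- Conjugation by `D i a` multiplies the parameter `s` of a transvection by `a`; `s = b / (a -
    -- 1)` is chosen so that `a * s = b + s`.
    have h1 : D i a * Matrix.transvection i j (b / (a - 1)) =
        Matrix.transvection i j b * Matrix.transvection i j (b / (a - 1)) * D i a := by
      rw [Matrix.transvection_mul_transvection_same _ _ hij]
      ext x y
      have hb : b / (a - 1) * a = b + b / (a - 1) := by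
        field_simp [sub_ne_zero.2 ha.2]
        ring
      simp only [D, Matrix.diagonal_mul, Matrix.mul_diagonal, Matrix.transvection,
        Matrix.add_apply, Matrix.one_apply, Matrix.single_apply]
      rcases eq_or_ne x y with rfl | hxy
      · have : ¬(i = x ∧ j = x) := fun h => hij (h.1.trans h.2.symm)
        simp [this]
      · by_cases h : i = x ∧ j = y
        · obtain ⟨rfl, rfl⟩ := h
          simp [hij, hij.symm, ← hb, mul_comm]
        · simp [h, hxy]
    have hT : Matrix.transvection i j (b / (a - 1)) * Matrix.transvection i j (-(b / (a - 1))) = 1 := by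
      rw [Matrix.transvection_mul_transvection_same _ _ hij]; simp
    have h2 := congrArg δ h1
    rw [map_mul, map_mul, map_mul, mul_comm] at h2
    have h3 := mul_right_cancel₀ (hne (hD i ha.1)) h2
    exact mul_eq_right₀ (hne hT) |>.1 h3.symm
  · intro A B hA hB
    rw [Matrix.SpecialLinearGroup.coe_mul, map_mul, hA, hB, one_mul]

/-! ### Linear maps that preserve the relations of the Veronese variety -/

theorem exists_eq_mul_of_forall_prime {R ι : Type*} [CommRing R] [IsDomain R]
    [UniqueFactorizationMonoid R] [Fintype ι] [Nonempty ι] (F : ι → R) :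
    ∃ (G : R) (u : ι → R), (∀ i, F i = G * u i) ∧ ∀ p, Prime p → ∃ i, ¬ p ∣ u i := by
  classical
  obtain ⟨h⟩ : Nonempty (NormalizedGCDMonoid R) := inferInstance
  obtain ⟨u, hu, hg⟩ := Finset.extract_gcd F Finset.univ_nonempty
  refine ⟨_, u, fun i => hu i (Finset.mem_univ i), fun p hp => ?_⟩
  by_contra! h
  have : p ∣ Finset.univ.gcd u := Finset.dvd_gcd fun i _ => h i
  rw [hg] at this
  exact hp.not_isUnit (isUnit_of_dvd_one this)

theorem dvd_of_forall_dvd_mul {R ι : Type*} [CommRing R] [IsDomain R]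
    [UniqueFactorizationMonoid R] {v : ι → R} (hv : ∀ p, Prime p → ∃ i, ¬ p ∣ v i) {a : R}
    (ha : a ≠ 0) {y : R} (h : ∀ i, a ∣ v i * y) : a ∣ y := by
  induction a using UniqueFactorizationMonoid.induction_on_prime generalizing y with
  | h₁ => exact absurd rfl ha
  | h₂ x hx => exact hx.dvd
  | h₃ a p ha0 hp ih =>
    obtain ⟨i, hi⟩ := hv p hp
    obtain ⟨z, rfl⟩ := (hp.dvd_or_dvd ((dvd_mul_right p a).trans (h i))).resolve_left hi
    refine mul_dvd_mul_left p (ih ha0 fun j => ?_)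
    refine (mul_dvd_mul_iff_left hp.ne_zero).1 ?_
    rw [mul_left_comm]
    exact h j

theorem linSubst_monomial {n : ℕ} (A : Matrix (Fin (n + 1)) (Fin (n + 1)) K)
    (α : Fin (n + 1) →₀ ℕ) :
    linSubst A (monomial α 1) = ∏ i, linSubst A (X i) ^ α i := by
  rw [monomial_eq, C_1, one_mul, Finsupp.prod_fintype _ _ (by simp), map_prod]
  simp only [map_pow]

/-- A point of the Veronese variety over the fraction field comes from a point of projective space.
Its coordinates `u i` are the `y` of `x_0^{d-1} x_i` divided by their gcd. The relations give `u_0^d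
y_α = u^α y(x_0^d)`, and coprimality of the `u i` then makes `u_0^d` divide `y(x_0^d)`; the quotient
is `c`. -/
theorem exists_factor_of_relations {n d : ℕ} (hd : 0 < d)
    {y : Mon n d → MvPolynomial (Fin (n + 1)) K} (hne : ∀ α, y α ≠ 0)
    (hrel : ∀ α β γ δ : Mon n d, α.1 + β.1 = γ.1 + δ.1 → y α * y β = y γ * y δ) :
    ∃ (c : MvPolynomial (Fin (n + 1)) K) (u : Fin (n + 1) → MvPolynomial (Fin (n + 1)) K),
      ∀ α : Mon n d, y α = c * ∏ i, u i ^ α.1 i := by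
  let m : Fin (n + 1) → Mon n d := fun i =>
    ⟨Finsupp.single 0 (d - 1) + Finsupp.single i 1, by
      rw [map_add, Finsupp.degree_single, Finsupp.degree_single]; omega⟩
  let s : Fin (n + 1) → Mon n d := fun i => ⟨Finsupp.single i d, by simp⟩
  obtain ⟨G, u, hu, hp⟩ := exists_eq_mul_of_forall_prime fun i => y (m i)
  have hG : G ≠ 0 := fun h => hne (m 0) (by rw [hu 0, h, zero_mul])
  have hu0 : u 0 ≠ 0 := fun h => hne (m 0) (by rw [hu 0, h, mul_zero])
  have hswap : ∀ (α β : Mon n d) (i j : Fin (n + 1)),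
      α.1 + Finsupp.single i 1 = β.1 + Finsupp.single j 1 → u i * y α = u j * y β := by
    intro α β i j h
    have := hrel (m i) α (m j) β (by
      simp only [m]
      rw [add_assoc, add_comm _ α.1, h, add_assoc, add_comm _ β.1])
    rw [hu, hu, mul_assoc, mul_assoc] at this
    exact mul_left_cancel₀ hG this
  -- Induction on the part of the degree not carried by `x_0`: each step trades one other variable
  -- for `x_0`.
  have hmain : ∀ (t : ℕ) (α : Mon n d), d - α.1 0 = t →
      u 0 ^ d * y α = (∏ i, u i ^ α.1 i) * y (s 0) := by
    intro t
    induction t with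
    | zero =>
      intro α h
      have hα : α = s 0 := by
        obtain ⟨α, hα⟩ := α
        refine Subtype.ext (Finsupp.ext fun i => ?_)
        rw [Finsupp.degree_eq_sum, Fin.sum_univ_succ] at hα
        refine Fin.cases ?_ (fun i => ?_) i
        · simp [s] at *; omega
        · have := Finset.single_le_sum (f := fun i : Fin n => α i.succ) (fun _ _ => Nat.zero_le _)
            (Finset.mem_univ i)
          simp [s] at *; omega
      subst hα
      congr 1
      simp only [s]
      rw [Finset.prod_eq_single 0 (fun i _ hi => by simp [Finsupp.single_eq_of_ne hi]) (by simp)]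
      simp
    | succ t ih =>
      intro α h
      obtain ⟨i, hi⟩ : ∃ i : Fin n, α.1 i.succ ≠ 0 := by
        by_contra! h0
        have := α.2
        rw [Finsupp.degree_eq_sum, Fin.sum_univ_succ] at this
        simp [h0] at this
        omega
      have hle : Finsupp.single i.succ 1 ≤ α.1 := by
        rw [Finsupp.single_le_iff]; omega
      obtain ⟨β, hβ⟩ := le_iff_exists_add.1 hle
      have hdeg : β.degree + 1 = d := by
        rw [← α.2, hβ]; simp [add_comm]
      let α' : Mon n d := ⟨β + Finsupp.single 0 1, by simpa using hdeg⟩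
      have h0 : α'.1 0 = α.1 0 + 1 := by simp [α', hβ]
      have h1 := ih α' (by omega)
      have h2 := hswap α α' 0 i.succ (by simp only [α', hβ]; abel)
      have h3 : u 0 * ∏ j, u j ^ α.1 j = u i.succ * ∏ j, u j ^ α'.1 j := by
        have e : ∀ (γ : Fin (n + 1) →₀ ℕ) (j : Fin (n + 1)),
            u j * ∏ l, u l ^ γ l = ∏ l, u l ^ (γ + Finsupp.single j 1 : Fin (n + 1) →₀ ℕ) l := by
          intro γ j
          simp only [Finsupp.add_apply, pow_add, Finset.prod_mul_distrib]
          rw [mul_comm, Finset.prod_eq_single (f := fun l => u l ^ (Finsupp.single j 1) l) j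
            (fun l _ hl => by simp [Finsupp.single_eq_of_ne hl]) (by simp)]
          simp
        rw [e, e]
        congr! 3
        simp only [α', hβ]; abel
      refine mul_left_cancel₀ hu0 ?_
      rw [mul_left_comm, h2, mul_left_comm, h1, ← mul_assoc, ← mul_assoc, h3]
  obtain ⟨c, hc⟩ : u 0 ^ d ∣ y (s 0) := by
    refine dvd_of_forall_dvd_mul (v := fun i => u i ^ d) (fun p hpp => ?_) (pow_ne_zero d hu0)
      fun i => ?_
    · obtain ⟨i, hi⟩ := hp p hpp
      exact ⟨i, fun h => hi (hpp.dvd_of_dvd_pow h)⟩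
    · have h := hmain _ (s i) rfl
      have e : ∏ j, u j ^ (s i).1 j = u i ^ d := by
        simp only [s]
        rw [Finset.prod_eq_single i (fun j _ hj => by simp [Finsupp.single_eq_of_ne hj]) (by simp)]
        simp
      exact ⟨y (s i), by rw [h, e]⟩
  refine ⟨c, u, fun α => mul_left_cancel₀ (pow_ne_zero d hu0) ?_⟩
  rw [hmain _ α rfl, hc]
  ring

theorem totalDegree_pow_eq {σ : Type*} (p : MvPolynomial σ K) (m : ℕ) :
    (p ^ m).totalDegree = m * p.totalDegree := by
  rcases eq_or_ne p 0 with rfl | hp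
  · rcases m with _ | m <;> simp
  · induction m with
    | zero => simp
    | succ m ih =>
      rw [pow_succ, totalDegree_mul_of_isDomain (pow_ne_zero m hp) hp, ih]
      ring

/-- Comparing degrees in `y(x_i^d) = c u_i^d` leaves two cases. Constant `u i` would make all `y α`
multiples of `c`, against independence when `n > 0`. Otherwise `c` is constant and the `u i` are
linear, and a `d`-th root of `c` is absorbed into them. -/
theorem exists_linSubst_of_relations [IsAlgClosed K] {n d : ℕ} (hn : 0 < n) (hd : 0 < d)
    {y : Mon n d → MvPolynomial (Fin (n + 1)) K} (hy : ∀ α, (y α).IsHomogeneous d)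
    (hli : LinearIndependent K y)
    (hrel : ∀ α β γ δ : Mon n d, α.1 + β.1 = γ.1 + δ.1 → y α * y β = y γ * y δ) :
    ∃ A : Matrix (Fin (n + 1)) (Fin (n + 1)) K, IsUnit A.det ∧
      ∀ α : Mon n d, y α = linSubst A (monomial α.1 1) := by
  obtain ⟨c, u, hcu⟩ := exists_factor_of_relations hd hli.ne_zero hrel
  let s : Fin (n + 1) → Mon n d := fun i => ⟨Finsupp.single i d, by simp⟩
  have hs : ∀ i, y (s i) = c * u i ^ d := fun i => by
    rw [hcu]
    simp only [s]
    rw [Finset.prod_eq_single i (fun j _ hj => by simp [Finsupp.single_eq_of_ne hj]) (by simp)]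
    simp
  have hne : ∀ i, c * u i ^ d ≠ 0 := fun i => hs i ▸ hli.ne_zero (s i)
  have hc : c ≠ 0 := left_ne_zero_of_mul (hne 0)
  have hu : ∀ i, u i ≠ 0 := fun i h => hne i (by rw [h, zero_pow hd.ne', mul_zero])
  have hdeg : ∀ i, d = c.totalDegree + d * (u i).totalDegree := fun i => by
    rw [← totalDegree_pow_eq, ← totalDegree_mul_of_isDomain hc (pow_ne_zero _ (hu i)),
      ← hs, (hy _).totalDegree (hli.ne_zero _)]
  have hdeg1 : ∀ i, (u i).totalDegree = 1 := by
    by_contra! h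
    obtain ⟨i, hi⟩ := h
    have hi0 : (u i).totalDegree = 0 := by
      have h1 := hdeg i
      rcases Nat.lt_or_ge (u i).totalDegree 2 with h2 | h2
      · omega
      · nlinarith
    have hcd : c.totalDegree = d := by
      have := hdeg i
      rw [hi0] at this; omega
    have hu0 : ∀ j, ∃ a, u j = C a := fun j => by
      have h1 := hdeg j
      rw [hcd] at h1
      have : d * (u j).totalDegree = 0 := by omega
      exact ⟨_, totalDegree_eq_zero_iff_eq_C.1 ((Nat.mul_eq_zero.1 this).resolve_left hd.ne')⟩
    choose a ha using hu0
    let j : Fin (n + 1) := ⟨1, by omega⟩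
    have hs01 : s 0 ≠ s j := fun h => by
      have := DFunLike.congr_fun (congrArg Subtype.val h) 0
      simp [s, j] at this
      omega
    have hp := hli.comp ![s 0, s j] (by
      intro x y
      fin_cases x <;> fin_cases y <;> simp [hs01, hs01.symm])
    have h0 := LinearIndependent.pair_iff.1 (by convert hp using 1; ext i; fin_cases i <;> rfl :
      LinearIndependent K ![y (s 0), y (s j)]) (a j ^ d) (-a 0 ^ d) (by
        rw [hs, hs, ha, ha, smul_eq_C_mul, smul_eq_C_mul]
        simp only [map_neg, map_pow]
        ring)
    have := hu 0
    rw [ha 0, (pow_eq_zero_iff hd.ne').1 (neg_eq_zero.1 h0.2), C_0] at this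
    exact this rfl
  have hc0 : c.totalDegree = 0 := by
    have := hdeg 0
    rw [hdeg1] at this; omega
  obtain ⟨c0, rfl⟩ : ∃ c0, c = C c0 := ⟨_, totalDegree_eq_zero_iff_eq_C.1 hc0⟩
  obtain ⟨a, rfl⟩ := IsAlgClosed.exists_pow_nat_eq c0 hd
  have hu1 : ∀ i, (u i).IsHomogeneous 1 := by
    intro i
    -- The constant term of `c u_i^d` is that of a form of positive degree, hence zero.
    have h0 : coeff 0 (u i) = 0 := by
      have h1 := (hy (s i)).coeff_eq_zero (d := 0) (by simpa using hd.ne)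
      rw [hs, ← constantCoeff_eq, map_mul, map_pow (constantCoeff) (u i), constantCoeff_C] at h1
      refine (pow_eq_zero_iff hd.ne').1 ((mul_eq_zero.1 h1).resolve_left fun h => hc ?_)
      rw [h, C_0]
    rw [← mem_homogeneousSubmodule]
    intro m hm
    have hw : Finsupp.weight 1 m = m.degree := by
      rw [Finsupp.degree_eq_weight_one]; rfl
    rw [hw]
    by_contra h
    refine hm ?_
    rcases Nat.lt_or_ge m.degree 1 with h2 | h2
    · have : m = 0 := by rw [← Finsupp.degree_eq_zero_iff]; omega
      rw [this, h0]
    · refine coeff_eq_zero_of_totalDegree_lt ?_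
      rw [hdeg1, ← Finsupp.degree_apply]
      omega
  have hB : ∀ j, ∃ b : Fin (n + 1) → K, ∑ i, b i • (X i : MvPolynomial (Fin (n + 1)) K) = u j := by
    intro j
    have := (mem_homogeneousSubmodule _ _).2 (hu1 j)
    rw [homogeneousSubmodule_one_eq_span_X] at this
    exact (Submodule.mem_span_range_iff_exists_fun K).1 this
  choose b hb using hB
  let A : Matrix (Fin (n + 1)) (Fin (n + 1)) K := Matrix.of fun i j => a * b j i
  have hAX : ∀ j, linSubst A (X j) = C a * u j := fun j => by
    rw [linSubst_X, ← hb, Finset.mul_sum]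
    refine Finset.sum_congr rfl fun i _ => ?_
    simp [A, smul_eq_C_mul, mul_assoc]
  have hyA : ∀ α : Mon n d, y α = linSubst A (monomial α.1 1) := by
    intro α
    rw [linSubst_monomial, hcu]
    simp only [hAX, mul_pow, Finset.prod_mul_distrib]
    rw [Finset.prod_pow_eq_pow_sum, ← Finsupp.degree_eq_sum, α.2, map_pow]
  refine ⟨A, ?_, hyA⟩
  rw [isUnit_iff_ne_zero]
  intro hdet
  -- A kernel vector would give a linear relation among the images of the `x_0^{d-1} x_i`.
  obtain ⟨v, hv, hv0⟩ := Matrix.exists_mulVec_eq_zero_iff.2 hdet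
  let m : Fin (n + 1) → Mon n d := fun i =>
    ⟨Finsupp.single 0 (d - 1) + Finsupp.single i 1, by
      rw [map_add, Finsupp.degree_single, Finsupp.degree_single]; omega⟩
  have hm : Function.Injective m := fun i j h => by
    have := add_left_cancel (congrArg Subtype.val h)
    exact Finsupp.single_left_injective one_ne_zero this
  have h1 := Fintype.linearIndependent_iff.1 (hli.comp m hm) v (by
    have h2 : ∀ i, v i • (y ∘ m) i =
        linSubst A (monomial (Finsupp.single 0 (d - 1)) 1) * (v i • linSubst A (X i)) := fun i => by
      rw [Function.comp_apply, hyA, mul_smul_comm, ← map_mul, X, monomial_mul, one_mul]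
    rw [Finset.sum_congr rfl fun i _ => h2 i, ← Finset.mul_sum]
    refine mul_eq_zero_of_right _ ?_
    simp only [linSubst_X, Finset.smul_sum]
    rw [Finset.sum_comm]
    refine Finset.sum_eq_zero fun i _ => ?_
    have h3 := congrFun hv0 i
    rw [Matrix.mulVec, dotProduct, Pi.zero_apply] at h3
    rw [← zero_mul (X i), ← C_0, ← h3, map_sum, Finset.sum_mul]
    refine Finset.sum_congr rfl fun j _ => ?_
    rw [smul_eq_C_mul, map_mul]
    ring)
  exact hv (funext h1)

/-! ### Homogeneous polynomial functions -/

instance (n m : ℕ) : Finite (Mon n m) := (Finsupp.finite_of_degree_eq m).to_subtype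

section HomogPolyFun

variable {n m : ℕ} {ι : Type*}

theorem IsHomogPolyFun.zero (e : ℕ) : IsHomogPolyFun e fun _ : Form n m K => 0 :=
  ⟨0, isHomogeneous_zero _ _ _, fun _ => by simp⟩

theorem IsHomogPolyFun.const (c : K) : IsHomogPolyFun 0 fun _ : Form n m K => c :=
  ⟨C c, isHomogeneous_C _ _, fun _ => by simp⟩

theorem IsHomogPolyFun.mul {a b : ℕ} {I J : Form n m K → K} (hI : IsHomogPolyFun a I)
    (hJ : IsHomogPolyFun b J) : IsHomogPolyFun (a + b) fun f => I f * J f := by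
  obtain ⟨P, hP, hPI⟩ := hI
  obtain ⟨Q, hQ, hQJ⟩ := hJ
  exact ⟨P * Q, hP.mul hQ, fun f => by simp only [hPI, hQJ, map_mul]⟩

theorem IsHomogPolyFun.const_mul {a : ℕ} {I : Form n m K → K} (c : K)
    (hI : IsHomogPolyFun a I) : IsHomogPolyFun a fun f => c * I f := by
  simpa using (IsHomogPolyFun.const c).mul hI

theorem IsHomogPolyFun.mul_const {a : ℕ} {I : Form n m K → K} (c : K)
    (hI : IsHomogPolyFun a I) : IsHomogPolyFun a fun f => I f * c := by
  simpa using hI.mul (IsHomogPolyFun.const c)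

theorem IsHomogPolyFun.sum {a : ℕ} {I : ι → Form n m K → K} (s : Finset ι)
    (hI : ∀ i ∈ s, IsHomogPolyFun a (I i)) : IsHomogPolyFun a fun f => ∑ i ∈ s, I i f := by
  choose! P hP hPI using hI
  refine ⟨∑ i ∈ s, P i, IsHomogeneous.sum _ _ _ hP, fun f => ?_⟩
  rw [map_sum]
  exact Finset.sum_congr rfl fun i hi => hPI i hi f

theorem IsHomogPolyFun.prod {a : ι → ℕ} {I : ι → Form n m K → K} (s : Finset ι)
    (hI : ∀ i ∈ s, IsHomogPolyFun (a i) (I i)) :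
    IsHomogPolyFun (∑ i ∈ s, a i) fun f => ∏ i ∈ s, I i f := by
  choose! P hP hPI using hI
  refine ⟨∏ i ∈ s, P i, IsHomogeneous.prod _ _ _ hP, fun f => ?_⟩
  rw [map_prod]
  exact Finset.prod_congr rfl fun i hi => hPI i hi f

theorem isHomogPolyFun_coeff {α : Fin (n + 1) →₀ ℕ} :
    IsHomogPolyFun 1 fun f : Form n m K => coeff α f.1 := by
  by_cases h : α.degree = m
  · exact ⟨X ⟨α, h⟩, isHomogeneous_X _ _, fun f => by simp [coords]⟩
  · convert IsHomogPolyFun.zero (K := K) (n := n) (m := m) 1 using 2 with f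
    exact ((mem_homogeneousSubmodule _ _).1 f.2).coeff_eq_zero h

/-- The coefficients of `F` are homogeneous polynomial functions of degree `a`. -/
def IsHomogPolyMap (a : ℕ) (F : Form n m K → MvPolynomial (Fin (n + 1)) K) : Prop :=
  ∀ α, IsHomogPolyFun a fun f => coeff α (F f)

theorem IsHomogPolyMap.one : IsHomogPolyMap 0 fun _ : Form n m K => 1 :=
  fun _ => IsHomogPolyFun.const _

theorem IsHomogPolyMap.mul {a b : ℕ} {F G : Form n m K → MvPolynomial (Fin (n + 1)) K}
    (hF : IsHomogPolyMap a F) (hG : IsHomogPolyMap b G) :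
    IsHomogPolyMap (a + b) fun f => F f * G f := fun α => by
  simp only [coeff_mul]
  exact IsHomogPolyFun.sum _ fun x _ => (hF x.1).mul (hG x.2)

theorem IsHomogPolyMap.prod {a : ι → ℕ} {F : ι → Form n m K → MvPolynomial (Fin (n + 1)) K}
    (s : Finset ι) (hF : ∀ i ∈ s, IsHomogPolyMap (a i) (F i)) :
    IsHomogPolyMap (∑ i ∈ s, a i) fun f => ∏ i ∈ s, F i f := by
  classical
  induction s using Finset.induction_on with
  | empty => simpa using IsHomogPolyMap.one
  | insert i s hi ih =>
    simp only [Finset.sum_insert hi, Finset.prod_insert hi]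
    exact (hF i (Finset.mem_insert_self i s)).mul
      (ih fun j hj => hF j (Finset.mem_insert_of_mem hj))

/-- The index set does not depend on `p`, unlike its support; this matters when `p` varies with the
form. -/
theorem pairing_eq_sum {l : ℕ} {p P : MvPolynomial (Fin (n + 1)) K} (hp : p.IsHomogeneous l) :
    pairing p P = ∑ α ∈ (Finsupp.finite_of_degree_eq (σ := Fin (n + 1)) l).toFinset,
      (∏ i, ((α i).factorial : K)) * (coeff α p * coeff α P) := by
  conv_lhs => rw [p.as_sum]
  rw [pairing_eq_bilin, map_sum, LinearMap.sum_apply]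
  simp only [← pairing_eq_bilin, pairing_monomial]
  rw [Finset.sum_subset (s₂ := (Finsupp.finite_of_degree_eq (σ := Fin (n + 1)) l).toFinset)]
  · exact Finset.sum_congr rfl fun α _ => by ring
  · intro α hα
    rw [Set.Finite.mem_toFinset]
    by_contra h
    exact mem_support_iff.1 hα (hp.coeff_eq_zero h)
  · intro α _ hα
    rw [notMem_support_iff.1 hα, zero_mul]

theorem IsHomogPolyMap.pairing {a b l : ℕ} {F G : Form n m K → MvPolynomial (Fin (n + 1)) K}
    (hF : IsHomogPolyMap a F) (hG : IsHomogPolyMap b G) (hl : ∀ f, (F f).IsHomogeneous l) :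
    IsHomogPolyFun (a + b) fun f => pairing (F f) (G f) := by
  simp only [pairing_eq_sum (hl _)]
  exact IsHomogPolyFun.sum _ fun α _ => ((hF α).mul (hG α)).const_mul _

theorem isHomogPolyFun_det {r : ℕ} {a : Fin r → ℕ} {S : Form n m K → Matrix (Fin r) (Fin r) K}
    (hS : ∀ i j, IsHomogPolyFun (a j) fun f => S f i j) :
    IsHomogPolyFun (∑ j, a j) fun f => (S f).det := by
  simp only [Matrix.det_apply']
  exact IsHomogPolyFun.sum _ fun σ _ => (IsHomogPolyFun.prod _ fun j _ => hS _ j).const_mul _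

/-- The `(i, j)` entry omits column `i` of `S`, so its degree depends on `i` alone, and each
`deltaDual` is homogeneous even if the `q_i` have different degrees. -/
theorem isHomogPolyFun_adjugate {r : ℕ} {a : Fin (r + 1) → ℕ}
    {S : Form n m K → Matrix (Fin (r + 1)) (Fin (r + 1)) K}
    (hS : ∀ i j, IsHomogPolyFun (a j) fun f => S f i j) (i j : Fin (r + 1)) :
    IsHomogPolyFun (∑ l, a (i.succAbove l)) fun f => (S f).adjugate i j := by
  simp only [Matrix.adjugate_fin_succ_eq_det_submatrix]
  exact (isHomogPolyFun_det fun _ l => hS _ (i.succAbove l)).const_mul _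

end HomogPolyFun

/-! ### The invariants -/

theorem coords_injective {n m : ℕ} : Function.Injective (coords : Form n m K → Mon n m → K) := by
  intro f g h
  refine Subtype.ext (MvPolynomial.ext _ _ fun α => ?_)
  by_cases hα : α.degree = m
  · exact congrFun h ⟨α, hα⟩
  · rw [((mem_homogeneousSubmodule _ _).1 f.2).coeff_eq_zero hα,
      ((mem_homogeneousSubmodule _ _).1 g.2).coeff_eq_zero hα]

theorem coords_surjective {n m : ℕ} :
    Function.Surjective (coords : Form n m K → Mon n m → K) := by
  intro v
  have := Fintype.ofFinite (Mon n m)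
  classical
  refine ⟨⟨∑ α : Mon n m, monomial α.1 (v α), Submodule.sum_mem _ fun α _ =>
    (mem_homogeneousSubmodule _ _).2 (isHomogeneous_monomial _ α.2)⟩, funext fun β => ?_⟩
  simp only [coords, coeff_sum, coeff_monomial]
  rw [Finset.sum_eq_single β]
  · simp
  · intro α _ h
    rw [if_neg fun h' => h (Subtype.ext h')]
  · simp

/-- The coefficients of a form as a linear equivalence. -/
def coordsEquiv (n m : ℕ) (K : Type*) [Field K] : Form n m K ≃ₗ[K] (Mon n m → K) :=
  LinearEquiv.ofBijective
    { toFun := coords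
      map_add' := fun f g => by ext α; simp [coords]
      map_smul' := fun c f => by ext α; simp [coords] }
    ⟨coords_injective, coords_surjective⟩

/-- The action of a matrix on forms by linear substitution. -/
def substForm {n : ℕ} (m : ℕ) :
    Matrix (Fin (n + 1)) (Fin (n + 1)) K →* Module.End K (Form n m K) where
  toFun A := (linSubst A).toLinearMap.restrict fun _ hf => linSubst_isHomogeneous A hf
  map_one' := by
    ext1 f
    refine Subtype.ext ?_
    simp [LinearMap.restrict_apply, linSubst_one]
  map_mul' A B := by
    ext1 f
    refine Subtype.ext ?_
    exact linSubst_mul_apply A B f.1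

theorem substForm_coe {n m : ℕ} (A : Matrix (Fin (n + 1)) (Fin (n + 1)) K) (f : Form n m K) :
    (substForm m A f).1 = linSubst A f.1 := rfl

/-- The matrix by which `SL_{n+1}` acts on forms. -/
def contragredient {n : ℕ} (g : Matrix.SpecialLinearGroup (Fin (n + 1)) K) :
    Matrix.SpecialLinearGroup (Fin (n + 1)) K :=
  (g⁻¹).transpose

theorem actSL_eq {n m : ℕ} (g : Matrix.SpecialLinearGroup (Fin (n + 1)) K) (f : Form n m K) :
    actSL g f = substForm m (contragredient g).1 f := by
  refine Subtype.ext ?_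
  rw [substForm_coe]
  simp only [actSL, act, ← map_inv]
  rfl

theorem det_substForm [Infinite K] {n m : ℕ}
    (g : Matrix.SpecialLinearGroup (Fin (n + 1)) K) : LinearMap.det (substForm m g.1) = 1 :=
  monoidHom_specialLinearGroup_eq_one (LinearMap.det.comp (substForm m)) g

section Data

variable {n m d r : ℕ} (e : Fin (r + 1) ≃ Mon n d) (q : Fin (r + 1) → Form n m K → Form n d K)

/-- The monomial basis. -/
def monBasis : Module.Basis (Fin (r + 1)) K (Form n d K) :=
  Module.Basis.ofEquivFun ((coordsEquiv n d K).trans (LinearEquiv.funCongrLeft K K e))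

theorem monBasis_repr (f : Form n d K) (i : Fin (r + 1)) :
    (monBasis e).repr f i = coeff (e i).1 f.1 := rfl

theorem basisMatrix_eq (f : Form n m K) :
    basisMatrix e q f = (monBasis e).toMatrix fun j => q j f := rfl

theorem pairing_deltaDual (i : Fin (r + 1)) (f : Form n m K)
    (h : ringChar K = 0 ∨ d < ringChar K) (P : MvPolynomial (Fin (n + 1)) K) :
    pairing (deltaDual e q i f).1 P =
      ∑ j, (basisMatrix e q f).adjugate i j * coeff (e j).1 P := by
  simp only [deltaDual, Submodule.coe_sum, Submodule.coe_smul, dualMonomial,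
    Matrix.transpose_apply]
  rw [pairing_eq_bilin, map_sum, LinearMap.sum_apply]
  refine Finset.sum_congr rfl fun j _ => ?_
  rw [map_smul, LinearMap.smul_apply, ← pairing_eq_bilin, pairing_monomial, smul_eq_mul,
    inv_mul_cancel_left₀ (prod_factorial_ne_zero h (e j).2.le)]

theorem pairing_deltaDual_self (i j : Fin (r + 1)) (f : Form n m K)
    (h : ringChar K = 0 ∨ d < ringChar K) :
    pairing (deltaDual e q i f).1 (q j f).1 = if i = j then Delta e q f else 0 := by
  rw [pairing_deltaDual e q i f h]
  have := congrFun (congrFun (Matrix.adjugate_mul (basisMatrix e q f)) i) j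
  rw [Matrix.mul_apply, Matrix.smul_apply, Matrix.one_apply, smul_eq_mul, mul_ite, mul_one,
    mul_zero] at this
  exact this

variable {q}

theorem basisMatrix_actSL (hq : ∀ i, IsCovariant (q i))
    (g : Matrix.SpecialLinearGroup (Fin (n + 1)) K) (f : Form n m K) :
    basisMatrix e q (actSL g f) =
      LinearMap.toMatrix (monBasis e) (monBasis e) (substForm d (contragredient g).1) *
        basisMatrix e q f := by
  ext i j
  rw [basisMatrix_eq, basisMatrix_eq, Module.Basis.toMatrix_apply, (hq j).2 g f, actSL_eq,
    ← LinearMap.toMatrix_mulVec_repr (monBasis e) (monBasis e)]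
  rfl

theorem Delta_actSL [Infinite K] (hq : ∀ i, IsCovariant (q i))
    (g : Matrix.SpecialLinearGroup (Fin (n + 1)) K) (f : Form n m K) :
    Delta e q (actSL g f) = Delta e q f := by
  rw [Delta, basisMatrix_actSL e hq, Matrix.det_mul, LinearMap.det_toMatrix, det_substForm,
    one_mul, Delta]

theorem transpose_mul_contragredient (g : Matrix.SpecialLinearGroup (Fin (n + 1)) K) :
    g.1.transpose * (contragredient g).1 = 1 := by
  have h : (g⁻¹).1 * g.1 = 1 := congrArg Subtype.val (inv_mul_cancel g)
  change g.1.transpose * (g⁻¹).1.transpose = 1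
  rw [← Matrix.transpose_mul, h, Matrix.transpose_one]

theorem pairing_actSL (g : Matrix.SpecialLinearGroup (Fin (n + 1)) K)
    (p P : MvPolynomial (Fin (n + 1)) K) :
    pairing (linSubst g.1 p) (linSubst (contragredient g).1 P) = pairing p P :=
  pairing_linSubst_linSubst (transpose_mul_contragredient g) p P

/-- The frame matrix changes from `S` to `M S`, and `adj(M S) = adj S · adj M`. Since `det M = 1`,
`adj M` is the inverse of `M`, the matrix of substitution by the transpose of `g`, which the pairing
moves to the other side. -/
theorem deltaDual_actSL [Infinite K] (h : ringChar K = 0 ∨ d < ringChar K)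
    (hq : ∀ i, IsCovariant (q i)) (g : Matrix.SpecialLinearGroup (Fin (n + 1)) K)
    (f : Form n m K) (i : Fin (r + 1)) :
    (deltaDual e q i (actSL g f)).1 = linSubst g.1 (deltaDual e q i f).1 := by
  refine sub_eq_zero.1 (eq_zero_of_pairing_left h ((deltaDual e q i _).2.sub
    (linSubst_isHomogeneous _ (deltaDual e q i f).2)) fun P hP => ?_)
  rw [pairing_comm, pairing_eq_bilin, map_sub, LinearMap.sub_apply, sub_eq_zero,
    ← pairing_eq_bilin, ← pairing_eq_bilin, pairing_linSubst, pairing_deltaDual e q i _ h,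
    pairing_deltaDual e q i _ h, basisMatrix_actSL e hq, Matrix.adjugate_mul_distrib]
  set M := LinearMap.toMatrix (monBasis e) (monBasis e) (substForm d (contragredient g).1)
  set M' := LinearMap.toMatrix (monBasis e) (monBasis e) (substForm d g.1.transpose) with hM'
  have hM : M' * M = 1 := by
    rw [← LinearMap.toMatrix_mul, ← map_mul, transpose_mul_contragredient, map_one,
      LinearMap.toMatrix_one]
  have hadj : M.adjugate = M' := by
    have := congrArg (M' * ·) (Matrix.mul_adjugate M)
    simp only [← Matrix.mul_assoc, hM, Matrix.one_mul] at this
    rw [this, LinearMap.det_toMatrix, det_substForm, one_smul, Matrix.mul_one]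
  have hP' : ∀ l, coeff (e l).1 (linSubst g.1.transpose P) =
      ∑ j, M' l j * coeff (e j).1 P := fun l =>
    (congrFun (LinearMap.toMatrix_mulVec_repr (monBasis e) (monBasis e)
      (substForm d g.1.transpose) ⟨P, hP⟩) l).symm
  simp only [hadj, Matrix.mul_apply, hP', Finset.sum_mul, Finset.mul_sum, mul_assoc]
  exact Finset.sum_comm

theorem isHomogPolyFun_basisMatrix {a : Fin (r + 1) → ℕ}
    (ha : ∀ i, ∀ α : Mon n d, IsHomogPolyFun (a i) fun f => coords (q i f) α)
    (i j : Fin (r + 1)) : IsHomogPolyFun (a j) fun f => basisMatrix e q f i j :=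
  ha j (e i)

theorem isInvariant_Delta [Infinite K] (hq : ∀ i, IsCovariant (q i)) :
    IsInvariant (Delta e q) := by
  choose a ha using fun i => (hq i).1
  exact ⟨⟨_, isHomogPolyFun_det (isHomogPolyFun_basisMatrix e ha)⟩, Delta_actSL e hq⟩

theorem isHomogPolyMap_deltaDual {a : Fin (r + 1) → ℕ}
    (ha : ∀ i, ∀ α : Mon n d, IsHomogPolyFun (a i) fun f => coords (q i f) α)
    (i : Fin (r + 1)) :
    IsHomogPolyMap (∑ l, a (i.succAbove l)) fun f => (deltaDual e q i f).1 := by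
  intro α
  simp only [deltaDual, Submodule.coe_sum, Submodule.coe_smul, coeff_sum, coeff_smul,
    Matrix.transpose_apply, smul_eq_mul]
  exact IsHomogPolyFun.sum _ fun j _ =>
    (isHomogPolyFun_adjugate (isHomogPolyFun_basisMatrix e ha) i j).mul_const _

theorem isHomogPolyMap_covariant {a : ℕ} {p : Form n m K → Form n d K}
    (ha : ∀ α : Mon n d, IsHomogPolyFun a fun f => coords (p f) α) :
    IsHomogPolyMap a fun f => (p f).1 := by
  intro α
  by_cases h : α.degree = d
  · exact ha ⟨α, h⟩
  · convert IsHomogPolyFun.zero (K := K) (n := n) (m := m) a using 2 with f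
    exact ((mem_homogeneousSubmodule _ _).1 (p f).2).coeff_eq_zero h

theorem isInvariant_formInvariant [Infinite K] {k : ℕ} {q : Fin (r + 1) → Form n m K → Form n d K}
    (h : ringChar K = 0 ∨ d < ringChar K) (hq : ∀ i, IsCovariant (q i))
    (i : Fin k → Fin (r + 1)) : IsInvariant (formInvariant e q i) := by
  choose a ha using fun i => (hq i).1
  refine ⟨⟨_, IsHomogPolyMap.pairing (l := ∑ _t : Fin k, d)
    (IsHomogPolyMap.prod Finset.univ fun t _ => isHomogPolyMap_deltaDual e ha (i t))
    (fun _ => isHomogPolyFun_coeff) fun f => IsHomogeneous.prod _ _ _ fun t _ =>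
      (deltaDual e q (i t) f).2⟩, fun g f => ?_⟩
  simp only [formInvariant, deltaDual_actSL e h hq, ← map_prod]
  rw [actSL_eq, substForm_coe, pairing_actSL]

theorem isInvariant_matrixInvariant [Infinite K] (h : ringChar K = 0 ∨ d < ringChar K)
    (hq : ∀ i, IsCovariant (q i)) (a b : Fin (r + 1) × Fin (r + 1)) :
    IsInvariant fun f => matrixInvariant e q f a b := by
  choose c hc using fun i => (hq i).1
  refine ⟨⟨_, IsHomogPolyMap.pairing (l := d + d)
    ((isHomogPolyMap_deltaDual e hc a.1).mul (isHomogPolyMap_deltaDual e hc a.2))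
    ((isHomogPolyMap_covariant (hc b.1)).mul (isHomogPolyMap_covariant (hc b.2)))
    fun f => IsHomogeneous.mul (deltaDual e q a.1 f).2 (deltaDual e q a.2 f).2⟩, fun g f => ?_⟩
  simp only [matrixInvariant, Matrix.of_apply, deltaDual_actSL e h hq, (hq _).2 g f]
  simp only [actSL_eq, substForm_coe, ← map_mul, pairing_actSL]

end Data

/-! ### Reconstruction -/

theorem linSubst_smul {n m : ℕ} (t : K) (A : Matrix (Fin (n + 1)) (Fin (n + 1)) K)
    {f : MvPolynomial (Fin (n + 1)) K} (hf : f.IsHomogeneous m) :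
    linSubst (t • A) f = t ^ m • linSubst A f := by
  have hX : ∀ j, linSubst (t • A) (X j) = C t * linSubst A (X j) := fun j => by
    simp [linSubst_X, Finset.mul_sum, mul_assoc]
  rw [f.as_sum, map_sum, map_sum, Finset.smul_sum]
  refine Finset.sum_congr rfl fun α hα => ?_
  have hdeg : α.degree = m := by
    by_contra h
    exact mem_support_iff.1 hα (hf.coeff_eq_zero h)
  rw [show monomial α (coeff α f) = coeff α f • monomial α 1 by rw [smul_monomial]; simp,
    map_smul, map_smul, smul_comm]
  congr 1
  rw [linSubst_monomial, linSubst_monomial]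
  simp only [hX, mul_pow, Finset.prod_mul_distrib]
  rw [Finset.prod_pow_eq_pow_sum, ← Finsupp.degree_eq_sum, hdeg, smul_eq_C_mul, map_pow]

theorem glEquivalent_of_linSubst {n m : ℕ} {A : Matrix (Fin (n + 1)) (Fin (n + 1)) K}
    (hA : IsUnit A.det) {f f' : Form n m K} (h : linSubst A f.1 = f'.1) : GLEquivalent f f' := by
  obtain ⟨G, hG⟩ := (Matrix.isUnit_iff_isUnit_det A.transpose).2 (by rwa [Matrix.det_transpose])
  -- `act` substitutes the inverse transpose, so `G` is taken to be the transpose of `A` and then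
  -- inverted.
  refine ⟨G⁻¹, Subtype.ext ?_⟩
  simp only [act, inv_inv, hG, Matrix.transpose_transpose]
  exact h

theorem glEquivalent_of_smul [IsAlgClosed K] {n m : ℕ} (hm : 0 < m)
    {A : Matrix (Fin (n + 1)) (Fin (n + 1)) K} (hA : IsUnit A.det) {c : K} (hc : c ≠ 0)
    {f f' : Form n m K} (h : c • linSubst A f.1 = f'.1) : GLEquivalent f f' := by
  obtain ⟨t, rfl⟩ := IsAlgClosed.exists_pow_nat_eq c hm
  have ht : t ≠ 0 := fun h0 => hc (by rw [h0, zero_pow hm.ne'])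
  refine glEquivalent_of_linSubst (A := t • A) ?_ ((linSubst_smul t A f.2).trans h)
  rw [Matrix.det_smul]
  exact (isUnit_iff_ne_zero.2 (pow_ne_zero _ ht)).mul hA

section Data

variable {n m d r : ℕ} (e : Fin (r + 1) ≃ Mon n d) (q : Fin (r + 1) → Form n m K → Form n d K)

theorem finrank_form (e : Fin (r + 1) ≃ Mon n d) : Module.finrank K (Form n d K) = r + 1 := by
  rw [Module.finrank_eq_card_basis (monBasis e), Fintype.card_fin]

theorem monBasis_apply (i : Fin (r + 1)) :
    (monBasis e i : Form n d K).1 = monomial (e i).1 (1 : K) := by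
  have h : monBasis e i =
      (⟨monomial (e i).1 1, isHomogeneous_monomial _ (e i).2⟩ : Form n d K) := by
    rw [Module.Basis.apply_eq_iff]
    ext j
    rw [monBasis_repr, coeff_monomial, Finsupp.single_apply]
    simp only [Subtype.val_injective.eq_iff, e.injective.eq_iff]
  rw [h]

theorem linearIndependent_iff_Delta_ne_zero (f : Form n m K) :
    (LinearIndependent K fun i => q i f) ↔ Delta e q f ≠ 0 := by
  have h := (monBasis e).is_basis_iff_det (v := fun i => q i f)
  rw [Module.Basis.det_apply, ← basisMatrix_eq, isUnit_iff_ne_zero] at h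
  refine ⟨fun hl => h.1 ⟨hl, ?_⟩, fun hd => (h.2 hd).1⟩
  have : FiniteDimensional K (Form n d K) := (monBasis e).finiteDimensional_of_finite
  exact hl.span_eq_top_of_card_eq_finrank' (by rw [finrank_form e, Fintype.card_fin])

theorem span_range_deltaDual (h : ringChar K = 0 ∨ d < ringChar K) {f : Form n m K}
    (hf : Delta e q f ≠ 0) :
    Submodule.span K (Set.range fun i => (deltaDual e q i f).1) =
      homogeneousSubmodule (Fin (n + 1)) K d := by
  have hli : LinearIndependent K fun i => deltaDual e q i f := by
    refine Fintype.linearIndependent_iff.2 fun c hc j => ?_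
    have h0 := congrArg (fun p : DualForm n d K => pairing p.1 (q j f).1) hc
    simp only [Submodule.coe_sum, Submodule.coe_smul, pairing_eq_bilin, map_sum, map_smul,
      LinearMap.sum_apply, LinearMap.smul_apply, Submodule.coe_zero, map_zero,
      LinearMap.zero_apply] at h0
    simp only [← pairing_eq_bilin, pairing_deltaDual_self e q _ _ f h] at h0
    simpa [hf] using h0
  have : FiniteDimensional K (Form n d K) := (monBasis e).finiteDimensional_of_finite
  have hs := hli.span_eq_top_of_card_eq_finrank' (by rw [finrank_form e, Fintype.card_fin])
  have := congrArg (Submodule.map (homogeneousSubmodule (Fin (n + 1)) K d).subtype) hs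
  rw [Submodule.map_span, Submodule.map_top, Submodule.range_subtype, ← Set.range_comp] at this
  exact this

theorem sum_matrixInvariant_eq (f : Form n m K) (a : Fin (r + 1) × Fin (r + 1) → K)
    (x : Fin (r + 1) × Fin (r + 1)) :
    ∑ b, matrixInvariant e q f x b * a b =
      pairing ((deltaDual e q x.1 f).1 * (deltaDual e q x.2 f).1)
        (∑ b, a b • ((q b.1 f).1 * (q b.2 f).1)) := by
  rw [pairing_eq_bilin, map_sum]
  refine Finset.sum_congr rfl fun b _ => ?_
  rw [map_smul, smul_eq_mul, mul_comm]
  rfl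

/-- The products `Δq_i^* Δq_j^*` span `Sym^{2d}(W)`, so the rows of the matrix detect every nonzero
form of degree `2d`. Consequently the matrix alone determines the quadratic relations among the
`q_i(f)`. -/
theorem matrixInvariant_kernel (h : ringChar K = 0 ∨ 2 * d < ringChar K) {f : Form n m K}
    (hf : Delta e q f ≠ 0) (a : Fin (r + 1) × Fin (r + 1) → K) :
    (∀ x, ∑ b, matrixInvariant e q f x b * a b = 0) ↔
      ∑ b, a b • ((q b.1 f).1 * (q b.2 f).1) = 0 := by
  simp only [sum_matrixInvariant_eq]
  refine ⟨fun h0 => ?_, fun h0 x => by rw [h0, pairing_eq_bilin, map_zero]⟩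
  refine eq_zero_of_pairing_prod (k := 2) (d := d) h
    (span_range_deltaDual e q (h.imp_right fun h => by omega) hf) ?_ fun i => ?_
  · refine IsHomogeneous.sum _ _ _ fun b _ => ?_
    rw [two_mul, smul_eq_C_mul]
    exact ((q b.1 f).2.mul (q b.2 f).2).C_mul _
  · rw [Fin.prod_univ_two]
    exact h0 (i 0, i 1)

theorem exists_linSubst_covariant [IsAlgClosed K] (hn : 0 < n) (hd : 0 < d)
    (h : ringChar K = 0 ∨ 2 * d < ringChar K) {f f' : Form n m K} (hf : Delta e q f ≠ 0)
    (hf' : Delta e q f' ≠ 0) (hM : matrixInvariant e q f = matrixInvariant e q f') :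
    ∃ A : Matrix (Fin (n + 1)) (Fin (n + 1)) K, IsUnit A.det ∧
      ∀ i, linSubst A (q i f).1 = (q i f').1 := by
  have hcard : Fintype.card (Fin (r + 1)) = Module.finrank K (Form n d K) := by
    rw [finrank_form e, Fintype.card_fin]
  have hli := (linearIndependent_iff_Delta_ne_zero e q f).2 hf
  have hli' := (linearIndependent_iff_Delta_ne_zero e q f').2 hf'
  let b := basisOfLinearIndependentOfCardEqFinrank hli hcard
  let b' := basisOfLinearIndependentOfCardEqFinrank hli' hcard
  have hb : ∀ i, b i = q i f := fun i => by simp [b]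
  have hb' : ∀ i, b' i = q i f' := fun i => by simp [b']
  let φ : Form n d K ≃ₗ[K] Form n d K := b.equiv b' (Equiv.refl _)
  have hφ : ∀ i, φ (q i f) = q i f' := fun i => by
    rw [← hb, ← hb', Module.Basis.equiv_apply, Equiv.refl_apply]
  have hrepr : ∀ u : Form n d K, u.1 = ∑ i, b.repr u i • (q i f).1 := fun u => by
    conv_lhs => rw [← b.sum_repr u]
    simp [hb]
  have hrepr' : ∀ u : Form n d K, (φ u).1 = ∑ i, b.repr u i • (q i f').1 := fun u => by
    conv_lhs => rw [← b.sum_repr u]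
    simp [hb, hφ]
  have hmul : ∀ u v : Form n d K, u.1 * v.1 = ∑ x : Fin (r + 1) × Fin (r + 1),
      (b.repr u x.1 * b.repr v x.2) • ((q x.1 f).1 * (q x.2 f).1) := fun u v => by
    rw [hrepr u, hrepr v, Finset.sum_mul_sum, ← Finset.sum_product']
    simp only [smul_mul_smul_comm, Finset.univ_product_univ]
  have hmul' : ∀ u v : Form n d K, (φ u).1 * (φ v).1 = ∑ x : Fin (r + 1) × Fin (r + 1),
      (b.repr u x.1 * b.repr v x.2) • ((q x.1 f').1 * (q x.2 f').1) := fun u v => by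
    rw [hrepr' u, hrepr' v, Finset.sum_mul_sum, ← Finset.sum_product']
    simp only [smul_mul_smul_comm, Finset.univ_product_univ]
  -- An equation `u v = w z` is a quadratic relation among the `q_i(f)`, hence a kernel vector of
  -- the common matrix, hence the same relation among the `q_i(f')`.
  have hrel : ∀ u v w z : Form n d K, u.1 * v.1 = w.1 * z.1 →
      (φ u).1 * (φ v).1 = (φ w).1 * (φ z).1 := fun u v w z huv => by
    rw [← sub_eq_zero, hmul, hmul, ← Finset.sum_sub_distrib] at huv
    rw [← sub_eq_zero, hmul', hmul', ← Finset.sum_sub_distrib]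
    simp only [← sub_smul] at huv ⊢
    rw [← matrixInvariant_kernel e q h hf' fun x : Fin (r + 1) × Fin (r + 1) =>
      b.repr u x.1 * b.repr v x.2 - b.repr w x.1 * b.repr z x.2, ← hM]
    exact (matrixInvariant_kernel e q h hf _).2 huv
  obtain ⟨A, hA, hy⟩ := exists_linSubst_of_relations hn hd
    (y := fun α => (φ (monBasis e (e.symm α))).1) (fun α => (φ _).2)
    (((((monBasis e).linearIndependent.comp _ e.symm.injective).map' φ.toLinearMap
      φ.ker).map' (homogeneousSubmodule (Fin (n + 1)) K d).subtype (Submodule.ker_subtype _)))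
    fun α β γ δ hαβ => hrel _ _ _ _ (by
      simp only [monBasis_apply, Equiv.apply_symm_apply, monomial_mul, hαβ])
  refine ⟨A, hA, fun i => ?_⟩
  have hφA : φ.toLinearMap = substForm d A := (monBasis e).ext fun j => Subtype.ext (by
    have := hy (e j)
    rw [Equiv.symm_apply_apply] at this
    rw [LinearEquiv.coe_coe, this, substForm_coe, monBasis_apply])
  rw [← substForm_coe, ← hφA, LinearEquiv.coe_coe, hφ]

end Data

theorem glEquivalent_of_values_eq [IsAlgClosed K] {n k d r : ℕ} (hn : 0 < n) (hk : 0 < k)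
    (hd : 0 < d) (hchar : ringChar K = 0 ∨ (k * d < ringChar K ∧ 2 * d < ringChar K))
    (e : Fin (r + 1) ≃ Mon n d) (q : Fin (r + 1) → Form n (k * d) K → Form n d K)
    {f f' : Form n (k * d) K} (hf : Delta e q f ≠ 0) (hf' : Delta e q f' ≠ 0)
    (hI : ∀ i : Fin k → Fin (r + 1), formInvariant e q i f = formInvariant e q i f')
    (hM : matrixInvariant e q f = matrixInvariant e q f') : GLEquivalent f f' := by
  have hchar1 : ringChar K = 0 ∨ d < ringChar K := hchar.imp_right fun h => by omega
  obtain ⟨A, hA, hAq⟩ :=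
    exists_linSubst_covariant e q hn hd (hchar.imp_right And.right) hf hf' hM
  let B := (A⁻¹).transpose
  have hBA : B.transpose * A = 1 := by
    rw [Matrix.transpose_transpose, Matrix.nonsing_inv_mul _ hA]
  let c := Delta e q f / Delta e q f'
  have hc : c ≠ 0 := div_ne_zero hf hf'
  -- Both sides pair equally with the basis `q_j(f')`; the ratio `c` compensates for the factors
  -- `Δ(f)` and `Δ(f')` in the dual bases.
  have hdual : ∀ i, linSubst B (deltaDual e q i f).1 = c • (deltaDual e q i f').1 := by
    intro i
    refine sub_eq_zero.1 (eq_zero_of_pairing_left hchar1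
      ((linSubst_isHomogeneous B (deltaDual e q i f).2).sub
        ((homogeneousSubmodule _ _ _).smul_mem c (deltaDual e q i f').2)) fun P hP => ?_)
    have hcard : Fintype.card (Fin (r + 1)) = Module.finrank K (Form n d K) := by
      rw [finrank_form e, Fintype.card_fin]
    let b := basisOfLinearIndependentOfCardEqFinrank
      ((linearIndependent_iff_Delta_ne_zero e q f').2 hf') hcard
    have h0 : (pairingBilin n K (linSubst B (deltaDual e q i f).1 -
        c • (deltaDual e q i f').1)).comp (homogeneousSubmodule (Fin (n + 1)) K d).subtype = 0 := by
      refine b.ext fun j => ?_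
      rw [coe_basisOfLinearIndependentOfCardEqFinrank, LinearMap.comp_apply, map_sub,
        LinearMap.sub_apply, map_smul, LinearMap.smul_apply, Submodule.subtype_apply,
        ← pairing_eq_bilin, ← pairing_eq_bilin, ← hAq j, pairing_linSubst_linSubst hBA, hAq j,
        pairing_deltaDual_self e q _ _ _ hchar1, pairing_deltaDual_self e q _ _ _ hchar1]
      by_cases hij : i = j
      · simp [hij, c, hf']
      · simp [hij]
    rw [pairing_comm]
    exact DFunLike.congr_fun h0 ⟨P, hP⟩
  refine glEquivalent_of_smul (Nat.mul_pos hk hd) hA (pow_ne_zero k hc) (sub_eq_zero.1 ?_)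
  refine eq_zero_of_pairing_prod (hchar.imp_right And.left)
    (span_range_deltaDual e q hchar1 hf')
    (((homogeneousSubmodule _ _ _).smul_mem _ (linSubst_isHomogeneous A f.2)).sub f'.2)
    fun i => ?_
  have h1 := hI i
  -- Each of the `k` factors contributes one `c`, so the values agree for `c ^ k • A f` and `f'`.
  rw [formInvariant, ← pairing_linSubst_linSubst hBA, map_prod] at h1
  simp only [hdual] at h1
  rw [Finset.prod_smul, Finset.prod_const, Finset.card_univ, Fintype.card_fin,
    pairing_eq_bilin, map_smul, LinearMap.smul_apply] at h1
  rw [pairing_eq_bilin, map_sub, map_smul, h1]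
  exact sub_self _

/-! ### The open subset of the quotient -/

theorem exists_eval_coords_ne_zero [Infinite K] {n m : ℕ} {P : MvPolynomial (Mon n m) K}
    (hP : P ≠ 0) : ∃ f : Form n m K, eval (coords f) P ≠ 0 := by
  by_contra! h
  refine hP (MvPolynomial.funext fun v => ?_)
  obtain ⟨f, rfl⟩ := coords_surjective v
  rw [h f, map_zero]

/-- A nonempty open set contains the nonvanishing locus of some nonzero invariant, and over an
infinite field a nonzero polynomial is nonzero at some form. -/
theorem exists_quotientPoint_mem [Infinite K] {n m : ℕ} {U : Set (Quotient n m K)}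
    (hU : IsOpen U) (hne : U.Nonempty) : ∃ f : Form n m K, quotientPoint f ∈ U := by
  obtain ⟨x, hx⟩ := hne
  obtain ⟨_, ⟨a, rfl⟩, hxa, haU⟩ :=
    PrimeSpectrum.isTopologicalBasis_basic_opens.exists_subset_of_mem_open hx hU
  have ha : a.1 ≠ 0 := fun h => hxa (by
    rw [Subtype.ext (a2 := (0 : invariantAlgebra n m K)) h]; exact x.asIdeal.zero_mem)
  obtain ⟨f, hf⟩ := exists_eval_coords_ne_zero ha
  exact ⟨f, haU fun h => hf h⟩

theorem exists_open_dense_iff_linearIndependent [Infinite K] {n m d r : ℕ}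
    (e : Fin (r + 1) ≃ Mon n d) {q : Fin (r + 1) → Form n m K → Form n d K}
    (hq : ∀ i, IsCovariant (q i)) (hgen : GenericallyLinearIndependent q) :
    ∃ U : Set (Quotient n m K), IsOpen U ∧ Dense U ∧
      ∀ f, quotientPoint f ∈ U ↔ LinearIndependent K fun i => q i f := by
  obtain ⟨⟨_, P, -, hP⟩, hinv⟩ := isInvariant_Delta e hq
  let D : invariantAlgebra n m K := ⟨P, fun g f => by rw [← hP, ← hP, hinv]⟩
  have hmem : ∀ f, quotientPoint f ∈ (PrimeSpectrum.basicOpen D : Set (Quotient n m K)) ↔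
      LinearIndependent K fun i => q i f := fun f => by
    rw [linearIndependent_iff_Delta_ne_zero e, hP]
    exact Iff.rfl
  refine ⟨PrimeSpectrum.basicOpen D, (PrimeSpectrum.basicOpen D).isOpen, ?_, hmem⟩
  obtain ⟨V, hV, hVd, hVq⟩ := hgen
  obtain ⟨f, hf⟩ := exists_quotientPoint_mem hV hVd.nonempty
  exact (PrimeSpectrum.basicOpen D).isOpen.dense ⟨_, (hmem f).2 (hVq f hf)⟩

end FormReconstruction

end

theorem mainTheorem2 {K : Type*} [Field K] [IsAlgClosed K]
    (n k d r : ℕ) (hn : 0 < n) (hk : 0 < k) (hd : 0 < d)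
    (hchar : ringChar K = 0 ∨ (k * d < ringChar K ∧ 2 * d < ringChar K))
    (e : Fin (r + 1) ≃ FormReconstruction.Mon n d)
    (q : Fin (r + 1) → FormReconstruction.Form n (k * d) K → FormReconstruction.Form n d K)
    (hq : ∀ i, FormReconstruction.IsCovariant (q i))
    (hgen : FormReconstruction.GenericallyLinearIndependent q) :
    (∀ i : Fin k → Fin (r + 1),
      FormReconstruction.IsInvariant (FormReconstruction.formInvariant e q i)) ∧
    (∀ a b : Fin (r + 1) × Fin (r + 1),
      FormReconstruction.IsInvariant fun f => FormReconstruction.matrixInvariant e q f a b) ∧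
    ∃ U : Set (FormReconstruction.Quotient n (k * d) K), IsOpen U ∧ Dense U ∧
      (∀ f, FormReconstruction.quotientPoint f ∈ U ↔ LinearIndependent K fun i => q i f) ∧
      ∃ R : ((Fin k → Fin (r + 1)) → K) →
          Matrix (Fin (r + 1) × Fin (r + 1)) (Fin (r + 1) × Fin (r + 1)) K →
          FormReconstruction.Form n (k * d) K,
        ∀ f, FormReconstruction.quotientPoint f ∈ U →
          FormReconstruction.GLEquivalent f
            (R (fun i => FormReconstruction.formInvariant e q i f)
              (FormReconstruction.matrixInvariant e q f)) := by

  have : Infinite K := IsAlgClosed.instInfinite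
  have hchar1 : ringChar K = 0 ∨ d < ringChar K := hchar.imp_right fun h => by omega
  refine ⟨FormReconstruction.isInvariant_formInvariant e hchar1 hq,
    FormReconstruction.isInvariant_matrixInvariant e hchar1 hq, ?_⟩
  obtain ⟨U, hU, hUd, hUq⟩ :=
    FormReconstruction.exists_open_dense_iff_linearIndependent e hq hgen
  refine ⟨U, hU, hUd, hUq, ?_⟩
  classical
  -- `R` picks any form over `U` with the prescribed values; the value 0 is used only for tuples
  -- that no form over `U` attains.
  refine ⟨fun v M => if h : ∃ f', FormReconstruction.quotientPoint f' ∈ U ∧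
      (fun i => FormReconstruction.formInvariant e q i f') = v ∧
      FormReconstruction.matrixInvariant e q f' = M then h.choose else 0, fun f hf => ?_⟩
  have h : ∃ f', FormReconstruction.quotientPoint f' ∈ U ∧
      (fun i : Fin k → Fin (r + 1) => FormReconstruction.formInvariant e q i f') =
        (fun i => FormReconstruction.formInvariant e q i f) ∧
      FormReconstruction.matrixInvariant e q f' = FormReconstruction.matrixInvariant e q f :=
    ⟨f, hf, rfl, rfl⟩
  simp only [dif_pos h]
  obtain ⟨hf', hv, hM⟩ := h.choose_spec
  have hΔ := fun f hf =>
    (FormReconstruction.linearIndependent_iff_Delta_ne_zero e q f).1 ((hUq f).1 hf)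
  exact FormReconstruction.glEquivalent_of_values_eq hn hk hd hchar e q (hΔ f hf) (hΔ _ hf')
    (fun i => (congrFun hv i).symm) hM.symm
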